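/- **The simple construction.** For a subspace $S\le\mathbb Z_2^n$ let $S^\perp=\{x:\langle x,a\rangle=0\ \forall a\in S\}$ and $|S\rangle=|S|^{-1/2}\sum_{x\in S}|x\rangle$. For every security parameter $\lambda\in\mathbb N$ fix parameters $n,t,N\in\mathbb N$, depending on $\lambda$, with $n>0$ even, $n=\Omega(\lambda)$, $t=\Theta(\sqrt n)$, $N$ bounded by a polynomial in $\lambda$, and let the collusion bound be $C=\lfloor n/(4t)\rfloor$, where $C\le N$. * Setup: sample a uniformly random $A\le\mathbb Z_2^n$ with $\dim A=\dim A^\perp=n/2$; independent uniform $v_1,\dots,v_{n/2}\in A$ and $w_1,\dots,w_{n/2}\in A^\perp$; and, for each $id\in[N]$, two sets $I_{id},J_{id}\subseteq[n/2]$, each consisting of $t$ indices sampled independently and uniformly from $[n/2]$ (with repetition). * Franchise: user $id$ gets the key $svk_{id}=(I_{id},J_{id},\{v_i\}_{i\in I_{id}},\{w_j\}_{j\in J_{id}})$. * Mint: the banknote is the $n$-qubit state $|A\rangle$. * Ver$(svk_{id},|P\rangle)$: with $V=\mathrm{span}\{v_i\}_{i\in I_{id}}$ and $W=\mathrm{span}\{w_j\}_{j\in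 J_{id}}$, measure membership of the computational basis label in $W^\perp$, apply the quantum Fourier transform over $\mathbb Z_2^n$, measure membership in $V^\perp$, apply the inverse transform; accept iff both tests pass, and return the resulting $n$-qubit state $|P'\rangle$ together with the verdict. **The sabotage game.** After Setup the adversary makes, adaptively and in any order, franchise queries (each returns one of the last $C$ keys $svk_{N-C+1},\dots,svk_N$), mint queries (each returns a banknote), and verify queries (it sends $n$ of its qubits and an index $id\in[N-C]$, and gets back the verdict and the post-verification state of Ver with $svk_{id}$). Finally it sends a purported banknote $|P\rangle$ (possibly entangled with its memory) and two distinct indices $id_1,id_2\in[N-C]$; the challenger runs Ver with $svk_{id_1}$ on $|P\rangle$ and then Ver with $svk_{id_2}$ on the resulting state. The adversary wins if the first verification accepts and the second rejects. **Theorem.** Consider any quantum adversary that receives at most one banknote (at most $m=1$ mint query) and runs in polynomial time, in the sense that in every run it performs at most $\mathrm{poly}(\lambda)$ steps, each of which is a gate from a fixed finite set of unitary gates, a single-qubit measurement in the computational basis, or a query; its memory starts in $|0\cdots0\rangle$, and it may be non-uniform and choose each step in an arbitrary way depending on the classical information received so far. Then its probability of winning the sabotage game is negligible: it is $o(\lambda^{-c})$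 for every constant $c$. -/

import Mathlib

open Asymptotics Filter
open scoped Matrix BigOperators

namespace FQM

/-! ## Linear algebra over the field with two elements -/

/-- Vectors of `ℤ₂ⁿ`; they also label the computational basis of an `n`-qubit register. -/
abbrev Vec (n : ℕ) : Type := Fin n → ZMod 2

/-- The orthogonal complement `S^⊥ = {x | ∀ a ∈ S, ⟨x, a⟩ = 0}` in `ℤ₂ⁿ`. -/
def perp {n : ℕ} (S : Submodule (ZMod 2) (Vec n)) : Submodule (ZMod 2) (Vec n) where
  carrier := {x | ∀ a ∈ S, x ⬝ᵥ a = 0}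
  add_mem' := by
    intro x y hx hy a ha
    rw [add_dotProduct, hx a ha, hy a ha, add_zero]
  zero_mem' := by
    intro a _
    exact zero_dotProduct a
  smul_mem' := by
    intro c x hx a ha
    rw [smul_dotProduct, hx a ha, smul_zero]

/-- The subspaces `A ≤ ℤ₂ⁿ` with `dim A = dim A^⊥ = n / 2`. -/
abbrev HalfSubspace (n : ℕ) : Type :=
  {A : Submodule (ZMod 2) (Vec n) //
    Module.finrank (ZMod 2) A = n / 2 ∧ Module.finrank (ZMod 2) (perp A) = n / 2}

noncomputable instance (n : ℕ) : Fintype (HalfSubspace n) := Fintype.ofFinite _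

noncomputable instance {n : ℕ} (S : Submodule (ZMod 2) (Vec n)) : Fintype S :=
  Fintype.ofFinite _

/-! ## Quantum registers -/

/-- Not necessarily normalized vectors of a `w`-qubit register.  The branch of an experiment in
which given measurement outcomes occurred is represented by the projected, unnormalized state;
its squared norm is the probability of the branch. -/
abbrev QState (w : ℕ) : Type := Vec w → ℂ

/-- Operators on a `w`-qubit register. -/
abbrev QOp (w : ℕ) : Type := Matrix (Vec w) (Vec w) ℂ

/-- Squared norm `⟨ψ|ψ⟩`. -/
noncomputable def normSq {w : ℕ} (ψ : QState w) : ℝ := ∑ x, ‖ψ x‖ ^ 2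

/-- The basis state `|0…0⟩`. -/
def zeroState (w : ℕ) : QState w := fun x => if x = 0 then 1 else 0

/-- The subspace state `|S⟩ = |S|^{-1/2} ∑_{x ∈ S} |x⟩`. -/
noncomputable def subspaceState {n : ℕ} (S : Submodule (ZMod 2) (Vec n)) : QState n :=
  open Classical in fun x => if x ∈ S then ((1 / Real.sqrt (Nat.card S) : ℝ) : ℂ) else 0

/-- The product state `|ψ⟩|φ⟩`, the qubits of `φ` being appended after those of `ψ`. -/
def tensor {w n : ℕ} (ψ : QState w) (φ : QState n) : QState (w + n) :=
  fun x => ψ (fun i => x (Fin.castAdd n i)) * φ (fun i => x (Fin.natAdd w i))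

/-- The operator that acts as `M` on the qubits selected by `e` and as the identity on all other
qubits of the register. -/
noncomputable def onWires {k w : ℕ} (e : Fin k ↪ Fin w) (M : QOp k) : QOp w :=
  open Classical in
  Matrix.of fun x y =>
    if ∀ i, i ∉ Set.range e → x i = y i then M (fun i => x (e i)) (fun i => y (e i)) else 0

/-- Projector onto the basis states of a register whose `i`-th qubit has the value `b`. -/
def bitProj {w : ℕ} (i : Fin w) (b : ZMod 2) : QOp w :=
  Matrix.diagonal fun x => if x i = b then 1 else 0

/-- The quantum Fourier transform over `ℤ₂ⁿ`. -/
noncomputable def qft (n : ℕ) : QOp n :=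
  Matrix.of fun x y => (((-1) ^ (x ⬝ᵥ y).val / Real.sqrt (2 ^ n) : ℝ) : ℂ)

/-- The measurement operators of the two-outcome test `O_S`: outcome `true` projects onto the
span of the basis states in `S`, outcome `false` onto the span of the remaining ones. -/
noncomputable def memberTest {n : ℕ} (S : Submodule (ZMod 2) (Vec n)) (b : Bool) : QOp n :=
  open Classical in Matrix.diagonal fun x => if (x ∈ S ↔ b = true) then 1 else 0

/-! ## The simple franchised quantum money construction -/

/-- Parameters for one value of the security parameter: the (even) number `n` of qubits of a
banknote, the number `t` of indices sampled per key half, the number `N` of verification keys.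
The collusion bound `C = n / (4 t)` must not exceed `N`. -/
structure Params where
  n : ℕ
  t : ℕ
  N : ℕ
  n_pos : 0 < n
  n_even : Even n
  collusion_le : n / (4 * t) ≤ N

/-- The collusion bound. -/
def Params.C (p : Params) : ℕ := p.n / (4 * p.t)

/-- Master secret keys
`(A, {v_i}, {w_j}, {I_id, J_id})`; `I id` and `J id` list the `t` sampled indices. -/
structure MSK (p : Params) where
  A : HalfSubspace p.n
  I : Fin p.N → Fin p.t → Fin (p.n / 2)
  J : Fin p.N → Fin p.t → Fin (p.n / 2)
  v : Fin (p.n / 2) → A.1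
  w : Fin (p.n / 2) → perp A.1

/-- `Setup`, given by its expectation functional: the expected value of `f msk` when `A`, all
sampled indices, all `v_i ∈ A` and all `w_j ∈ A^⊥` are independent and uniform
(`𝔼` is the average over a finite type). -/
noncomputable def setupExpect (p : Params) (f : MSK p → ℝ) : ℝ :=
  𝔼 A : HalfSubspace p.n,
    𝔼 I : Fin p.N → Fin p.t → Fin (p.n / 2), 𝔼 J : Fin p.N → Fin p.t → Fin (p.n / 2),
      𝔼 v : Fin (p.n / 2) → A.1, 𝔼 w : Fin (p.n / 2) → perp A.1, f ⟨A, I, J, v, w⟩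

/-- Half of a verification key: a set of indices and the vectors with these indices. -/
abbrev HalfKey (n : ℕ) : Type := (I : Finset (Fin (n / 2))) × (I → Vec n)

/-- Secret verification keys `(I, {v_i}_{i ∈ I})`, `(J, {w_j}_{j ∈ J})`. -/
abbrev SVK (n : ℕ) : Type := HalfKey n × HalfKey n

/-- The subspace spanned by the vectors of a half key. -/
def HalfKey.span {n : ℕ} (k : HalfKey n) : Submodule (ZMod 2) (Vec n) :=
  Submodule.span (ZMod 2) (Set.range k.2)

/-- `Franchise`: the verification key of the user `id`. -/
def franchise {p : Params} (msk : MSK p) (id : Fin p.N) : SVK p.n :=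
  (⟨Finset.univ.image (msk.I id), fun i => (msk.v i : Vec p.n)⟩,
   ⟨Finset.univ.image (msk.J id), fun j => (msk.w j : Vec p.n)⟩)

/-- `Mint`: the banknote `|A⟩`. -/
noncomputable def mint {p : Params} (msk : MSK p) : QState p.n := subspaceState msk.A.1

/-- `Ver` as a quantum instrument: the operator applied to the banknote when the computational
basis test (membership in `W^⊥`) has outcome `c.1` and the Fourier basis test (membership in
`V^⊥`) has outcome `c.2`. -/
noncomputable def verOp {n : ℕ} (k : SVK n) (c : Bool × Bool) : QOp n :=
  (qft n)ᴴ * memberTest (perp k.1.span) c.2 * qft n * memberTest (perp k.2.span) c.1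

/-- `Ver` accepts iff both tests pass. -/
def accepts (c : Bool × Bool) : Bool := c.1 && c.2

/-- The users in `[N - C]`, whose keys are not given to the adversary. -/
abbrev Honest (p : Params) : Type := Fin (p.N - p.C)

/-- The key of a user in `[N - C]`. -/
def honestKey {p : Params} (msk : MSK p) (id : Honest p) : SVK p.n :=
  franchise msk (Fin.castLE (Nat.sub_le _ _) id)

/-- The `j`-th of the last `C` keys. -/
def colluderKey {p : Params} (msk : MSK p) (j : Fin p.C) : SVK p.n :=
  franchise msk ⟨p.N - p.C + j, by
    have h : p.C ≤ p.N := p.collusion_le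
    have hj := j.isLt
    omega⟩

/-! ## Adversaries and the sabotage game -/

/-- A finite set of quantum gates. -/
structure GateSet where
  card : ℕ
  arity : Fin card → ℕ
  gate : ∀ g : Fin card, Matrix.unitaryGroup (Vec (arity g)) ℂ

/-- Interactive quantum algorithms, over the gate set `G`, that play the sabotage game; the index
is the current number of qubits in their memory.  They are adaptive: the continuation may depend
in an arbitrary way on all classical data seen so far. -/
inductive Adversary (p : Params) (G : GateSet) : ℕ → Type
  /-- Apply a gate to chosen qubits. -/
  | gate {w : ℕ} (g : Fin G.card) (e : Fin (G.arity g) ↪ Fin w) (next : Adversary p G w) :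
      Adversary p G w
  /-- Measure a qubit in the computational basis. -/
  | measure {w : ℕ} (i : Fin w) (next : ZMod 2 → Adversary p G w) : Adversary p G w
  /-- Franchise query: obtain the `j`-th of the last `C` verification keys. -/
  | franchise {w : ℕ} (j : Fin p.C) (next : SVK p.n → Adversary p G w) : Adversary p G w
  /-- Mint query: obtain a valid banknote, `n` fresh qubits. -/
  | mint {w : ℕ} (next : Adversary p G (w + p.n)) : Adversary p G w
  /-- Verify query: send the qubits `e` to the user `id`; get them and the verdict back. -/
  | verify {w : ℕ} (id : Honest p) (e : Fin p.n ↪ Fin w) (next : Bool → Adversary p G w) :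
      Adversary p G w
  /-- Challenge: send the qubits `e` and two distinct users, and stop. -/
  | challenge {w : ℕ} (id₁ id₂ : Honest p) (hne : id₁ ≠ id₂) (e : Fin p.n ↪ Fin w) :
      Adversary p G w

namespace Adversary

variable {p : Params} {G : GateSet}

/-- Running time: the maximal number of gates, measurements and queries in a run. -/
def time : {w : ℕ} → Adversary p G w → ℕ
  | _, gate _ _ next => next.time + 1
  | _, measure _ next => (Finset.univ.sup fun b => (next b).time) + 1
  | _, franchise _ next => (Finset.univ.sup fun k => (next k).time) + 1
  | _, mint next => next.time + 1
  | _, verify _ _ next => (Finset.univ.sup fun b => (next b).time) + 1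
  | _, challenge _ _ _ _ => 1

/-- The maximal number of mint queries in a run. -/
def mints : {w : ℕ} → Adversary p G w → ℕ
  | _, gate _ _ next => next.mints
  | _, measure _ next => Finset.univ.sup fun b => (next b).mints
  | _, franchise _ next => Finset.univ.sup fun k => (next k).mints
  | _, mint next => next.mints + 1
  | _, verify _ _ next => Finset.univ.sup fun b => (next b).mints
  | _, challenge _ _ _ _ => 0

/-- Probability that the run from the memory state `ψ` (unnormalized, weighted with the
probability of having reached it) ends in successful sabotage: the first verification of the
challenge accepts and the second one, run on the state left by the first, rejects. -/
noncomputable def winProb (msk : MSK p) : {w : ℕ} → Adversary p G w → QState w → ℝ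
  | _, gate g e next, ψ => next.winProb msk (onWires e (G.gate g : QOp (G.arity g)) *ᵥ ψ)
  | _, measure i next, ψ => ∑ b : ZMod 2, (next b).winProb msk (bitProj i b *ᵥ ψ)
  | _, franchise j next, ψ => (next (colluderKey msk j)).winProb msk ψ
  | _, mint next, ψ => next.winProb msk (tensor ψ (FQM.mint msk))
  | _, verify id e next, ψ =>
      ∑ c : Bool × Bool,
        (next (accepts c)).winProb msk (onWires e (verOp (honestKey msk id) c) *ᵥ ψ)
  | _, challenge id₁ id₂ _ e, ψ =>
      ∑ c : Bool × Bool, ∑ d : Bool × Bool,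
        if accepts c = true ∧ accepts d = false then
          normSq (onWires e (verOp (honestKey msk id₂) d) *ᵥ
            (onWires e (verOp (honestKey msk id₁) c) *ᵥ ψ))
        else 0

end Adversary

/-- The probability of winning the sabotage game, starting with `Setup` and with the adversary's
memory in the state `|0…0⟩`. -/
noncomputable def sabotageProb {p : Params} {G : GateSet} {w : ℕ} (adv : Adversary p G w) : ℝ :=
  setupExpect p fun msk => adv.winProb msk (zeroState w)

/-! ## Asymptotics -/

/-- `f(λ) = o(λ^{-c})` for every constant `c`. -/
def Negligible (f : ℕ → ℝ) : Prop :=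
  ∀ c : ℝ, f =o[atTop] fun l : ℕ => (l : ℝ) ^ (-c)

/-- `f` is bounded by a polynomial. -/
def PolyBounded (f : ℕ → ℕ) : Prop :=
  ∃ P : Polynomial ℕ, ∀ l, f l ≤ P.eval l

/-- Security against sabotage of the simple construction, with parameters `p l` at security
parameter `l`, for adversaries that receive at most `m` banknotes: every (non-uniform)
polynomial-time quantum adversary over a finite gate set, with memory of any initial size `w l`,
has negligible winning probability. -/
def SecureAgainstSabotage (p : ℕ → Params) (m : ℕ) : Prop :=
  ∀ (G : GateSet) (w : ℕ → ℕ) (adv : ∀ l, Adversary (p l) G (w l)),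
    PolyBounded (fun l => (adv l).time) → (∀ l, (adv l).mints ≤ m) →
      Negligible fun l => sabotageProb (adv l)

end FQM

/-!
The adversary may even know `A` and all sampled indices: the only secret used is the vectors `v i`,
`w j` whose indices lie in no colluder's key.  Fix `A`, the indices, and the colluders' vectors,
and compare every honest verification with the *ideal* one, which tests membership of the label in
`A^⊥⊥` and of the Fourier label in `A^⊥`.

An honest key differs from the ideal test, on a fixed state, only by accepting labels outside
`A^⊥⊥` (or Fourier labels outside `A^⊥`), and a fixed such label survives each fresh uniform vector
of the key with probability `1 / 2` (`expect_forall_orthogonal`, `expect_normSq_verOp_sub_le`).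
Since the `C = ⌊n / (4 t)⌋` colluders hold at most half of the `n / 2` indices, each sample of an
honest key is fresh and new with probability at least `1 / 4`, and the averaged error is at most
`(7 / 8) ^ t` (`expect_half_pow_card_sdiff_le`).  This error is exponentially small in
`t = Θ(√n)`, and a union bound over the polynomially many users is affordable.

In the hybrid argument (`expect_winProb_le`) the honest verifications are replaced by the ideal one
in the order in which they occur, so that the state to be verified never depends on the secret
vectors.  The winning probability is a sum of squared norms of linear images of the state, so that
`‖ψ + φ‖² ≤ (1 + δ) ‖ψ‖² + (1 + δ⁻¹) ‖φ‖²` applies to it; with `δ` the inverse of the running time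
the factors `1 + δ` multiply to at most `e`, and no square roots of errors arise.
After the last replacement nothing is left to win: the two ideal projectors commute, so a state
accepted by the ideal verification lies in the range of both, and every honest key accepts it with
certainty (`testOp_mul_idealOp_accept`).
-/

namespace FQM

/-! ### Squared norms and operators on selected qubits -/

lemma normSq_nonneg {w : ℕ} (ψ : QState w) : 0 ≤ normSq ψ :=
  Finset.sum_nonneg fun _ _ => by positivity

@[simp] lemma normSq_zero {w : ℕ} : normSq (0 : QState w) = 0 := by
  simp [normSq]

/-- Squared norms are subadditive up to a factor `1 + δ` on the first summand.  Taking `δ` to be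
the inverse of the number of steps keeps the product of all these factors bounded. -/
lemma normSq_add_le {w : ℕ} {δ : ℝ} (hδ : 0 < δ) (ψ φ : QState w) :
    normSq (ψ + φ) ≤ (1 + δ) * normSq ψ + (1 + δ⁻¹) * normSq φ := by
  unfold normSq
  rw [Finset.mul_sum, Finset.mul_sum, ← Finset.sum_add_distrib]
  refine Finset.sum_le_sum fun x _ => ?_
  have h1 : ‖(ψ + φ) x‖ ^ 2 ≤ (‖ψ x‖ + ‖φ x‖) ^ 2 :=
    pow_le_pow_left₀ (norm_nonneg _) (norm_add_le _ _) 2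
  have h2 : 0 ≤ δ⁻¹ * (δ * ‖ψ x‖ - ‖φ x‖) ^ 2 := by positivity
  have h3 : δ⁻¹ * (δ * ‖ψ x‖ - ‖φ x‖) ^ 2
      = δ * ‖ψ x‖ ^ 2 - 2 * (‖ψ x‖ * ‖φ x‖) + δ⁻¹ * ‖φ x‖ ^ 2 := by
    field_simp
    ring
  nlinarith

lemma ofReal_normSq {w : ℕ} (ψ : QState w) : ((normSq ψ : ℝ) : ℂ) = star ψ ⬝ᵥ ψ := by
  simp [normSq, dotProduct, Complex.conj_mul']

lemma normSq_mulVec_of_isometry {w : ℕ} {U : QOp w} (hU : Uᴴ * U = 1) (ψ : QState w) :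
    normSq (U *ᵥ ψ) = normSq ψ := by
  have h : ((normSq (U *ᵥ ψ) : ℝ) : ℂ) = (normSq ψ : ℝ) := by
    rw [ofReal_normSq, ofReal_normSq, Matrix.star_mulVec, Matrix.dotProduct_mulVec,
      Matrix.vecMul_vecMul, hU, Matrix.vecMul_one]
  exact_mod_cast h

/-- A label of a `w`-qubit basis state, split into the part on the qubits selected by `e` and the
part on the remaining qubits. -/
noncomputable def splitWires {k w : ℕ} (e : Fin k ↪ Fin w) :
    Vec w ≃ Vec k × ({i // i ∉ Set.range e} → ZMod 2) :=
  open Classical in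
  { toFun := fun x => (fun i => x (e i), fun i => x i)
    invFun := fun p i => if h : i ∈ Set.range e then p.1 h.choose else p.2 ⟨i, h⟩
    left_inv := fun x => by
      funext i
      by_cases h : i ∈ Set.range e
      · simp only [h, dif_pos]
        rw [h.choose_spec]
      · simp [h]
    right_inv := fun p => by
      refine Prod.ext ?_ ?_
      · funext i
        have h : e i ∈ Set.range e := ⟨i, rfl⟩
        simp only [h, dif_pos]
        rw [e.injective h.choose_spec]
      · funext i
        simp only [i.2, not_false_eq_true, dif_neg] }

lemma splitWires_symm_apply_mem {k w : ℕ} (e : Fin k ↪ Fin w) (y : Vec k)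
    (r : {i // i ∉ Set.range e} → ZMod 2) (i : Fin k) :
    (splitWires e).symm (y, r) (e i) = y i :=
  congrFun (congrArg Prod.fst ((splitWires e).apply_symm_apply (y, r))) i

lemma splitWires_symm_apply_notMem {k w : ℕ} (e : Fin k ↪ Fin w) (y : Vec k)
    (r : {i // i ∉ Set.range e} → ZMod 2) (i : {i // i ∉ Set.range e}) :
    (splitWires e).symm (y, r) i = r i :=
  congrFun (congrArg Prod.snd ((splitWires e).apply_symm_apply (y, r))) i

/-- The state of the selected qubits when the other qubits have the basis label `r`.  An operator
on the selected qubits acts on each slice separately. -/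
noncomputable def slice {k w : ℕ} (e : Fin k ↪ Fin w) (r : {i // i ∉ Set.range e} → ZMod 2)
    (ψ : QState w) : QState k :=
  fun y => ψ ((splitWires e).symm (y, r))

lemma slice_ext {k w : ℕ} (e : Fin k ↪ Fin w) {ψ φ : QState w}
    (h : ∀ r, slice e r ψ = slice e r φ) : ψ = φ := by
  funext x
  have := congrFun (h (splitWires e x).2) (splitWires e x).1
  simpa [slice] using this

lemma normSq_eq_sum_slice {k w : ℕ} (e : Fin k ↪ Fin w) (ψ : QState w) :
    normSq ψ = ∑ r, normSq (slice e r ψ) := by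
  unfold normSq slice
  rw [← Equiv.sum_comp (splitWires e).symm, Fintype.sum_prod_type_right]

lemma slice_onWires {k w : ℕ} (e : Fin k ↪ Fin w) (M : QOp k) (ψ : QState w)
    (r : {i // i ∉ Set.range e} → ZMod 2) :
    slice e r (onWires e M *ᵥ ψ) = M *ᵥ slice e r ψ := by
  classical
  funext y
  simp only [slice, Matrix.mulVec, dotProduct]
  rw [← Equiv.sum_comp (splitWires e).symm, Fintype.sum_prod_type]
  refine Finset.sum_congr rfl fun y' _ => ?_
  rw [Finset.sum_eq_single r]
  · rw [onWires, Matrix.of_apply, if_pos]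
    · simp only [splitWires_symm_apply_mem]
    · intro i hi
      rw [splitWires_symm_apply_notMem e y r ⟨i, hi⟩, splitWires_symm_apply_notMem e y' r ⟨i, hi⟩]
  · intro r' _ hr
    rw [onWires, Matrix.of_apply, if_neg, zero_mul]
    intro h
    refine hr (funext fun i => ?_)
    have := h i i.2
    rwa [splitWires_symm_apply_notMem, splitWires_symm_apply_notMem, eq_comm] at this
  · simp

lemma normSq_onWires_mulVec {k w : ℕ} (e : Fin k ↪ Fin w) (M : QOp k) (ψ : QState w) :
    normSq (onWires e M *ᵥ ψ) = ∑ r, normSq (M *ᵥ slice e r ψ) := by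
  simp_rw [normSq_eq_sum_slice e, slice_onWires]

lemma slice_add {k w : ℕ} (e : Fin k ↪ Fin w) (r : {i // i ∉ Set.range e} → ZMod 2)
    (ψ φ : QState w) : slice e r (ψ + φ) = slice e r ψ + slice e r φ := rfl

lemma onWires_add_mulVec {k w : ℕ} (e : Fin k ↪ Fin w) (M M' : QOp k) (ψ : QState w) :
    onWires e (M + M') *ᵥ ψ = onWires e M *ᵥ ψ + onWires e M' *ᵥ ψ := by
  refine slice_ext e fun r => ?_
  simp only [slice_add, slice_onWires, Matrix.add_mulVec]

lemma onWires_mul_mulVec {k w : ℕ} (e : Fin k ↪ Fin w) (M M' : QOp k) (ψ : QState w) :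
    onWires e (M * M') *ᵥ ψ = onWires e M *ᵥ (onWires e M' *ᵥ ψ) := by
  refine slice_ext e fun r => ?_
  rw [slice_onWires, slice_onWires, slice_onWires, Matrix.mulVec_mulVec]

lemma onWires_zero_mulVec {k w : ℕ} (e : Fin k ↪ Fin w) (ψ : QState w) :
    onWires e (0 : QOp k) *ᵥ ψ = 0 := by
  refine slice_ext e fun r => ?_
  rw [slice_onWires, Matrix.zero_mulVec]
  rfl

lemma normSq_onWires_isometry {k w : ℕ} (e : Fin k ↪ Fin w) {U : QOp k} (hU : Uᴴ * U = 1)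
    (ψ : QState w) : normSq (onWires e U *ᵥ ψ) = normSq ψ := by
  simp_rw [normSq_onWires_mulVec, normSq_mulVec_of_isometry hU, ← normSq_eq_sum_slice]

lemma sum_normSq_bitProj {w : ℕ} (i : Fin w) (ψ : QState w) :
    ∑ b : ZMod 2, normSq (bitProj i b *ᵥ ψ) = normSq ψ := by
  unfold normSq bitProj
  rw [Finset.sum_comm]
  refine Finset.sum_congr rfl fun x _ => ?_
  simp only [Matrix.mulVec_diagonal]
  rw [Finset.sum_eq_single (x i)]
  · simp
  · intro b _ hb
    simp [hb.symm]
  · simp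

lemma normSq_tensor {w n : ℕ} (ψ : QState w) (φ : QState n) :
    normSq (tensor ψ φ) = normSq ψ * normSq φ := by
  unfold normSq tensor
  rw [← Equiv.sum_comp (Fin.appendEquiv w n), Fintype.sum_prod_type, Finset.sum_mul_sum]
  refine Finset.sum_congr rfl fun x _ => Finset.sum_congr rfl fun y _ => ?_
  simp [Fin.appendEquiv, mul_pow]

lemma tensor_add {w n : ℕ} (ψ ψ' : QState w) (φ : QState n) :
    tensor (ψ + ψ') φ = tensor ψ φ + tensor ψ' φ := by
  funext x
  simp [tensor, add_mul]

lemma normSq_zeroState (w : ℕ) : normSq (zeroState w) = 1 := by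
  unfold normSq zeroState
  rw [Finset.sum_eq_single 0]
  · simp
  · intro b _ hb
    simp [hb]
  · simp

lemma normSq_subspaceState {n : ℕ} (S : Submodule (ZMod 2) (Vec n)) :
    normSq (subspaceState S) = 1 := by
  classical
  have hS : (0 : ℝ) < Nat.card S := by exact_mod_cast Nat.card_pos
  have h : ∀ x : Vec n, ‖subspaceState S x‖ ^ 2 = if x ∈ S then (1 / (Nat.card S : ℝ)) else 0 := by
    intro x
    unfold subspaceState
    split_ifs
    · rw [Complex.norm_real, Real.norm_eq_abs, sq_abs, div_pow, one_pow,
        Real.sq_sqrt hS.le]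
    · simp
  unfold normSq
  simp_rw [h]
  rw [← Finset.sum_filter, Finset.sum_const, nsmul_eq_mul, ← Fintype.card_subtype,
    ← Nat.card_eq_fintype_card]
  exact mul_one_div_cancel hS.ne'

/-! ### Characters, the Fourier transform and membership tests -/

lemma neg_one_pow_val_add (a b : ZMod 2) :
    (-1 : ℝ) ^ (a + b).val = (-1) ^ a.val * (-1) ^ b.val := by
  have h : ∀ a b : ZMod 2, (-1 : ℤ) ^ (a + b).val = (-1) ^ a.val * (-1) ^ b.val := by decide
  exact_mod_cast h a b

lemma ne_zero_iff_eq_one (a : ZMod 2) : a ≠ 0 ↔ a = 1 := by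
  revert a
  decide

/-- A character of `ℤ₂ⁿ` that is nontrivial on a subspace sums to zero over it. -/
lemma sum_character_eq_zero {n : ℕ} (S : Submodule (ZMod 2) (Vec n)) {u : Vec n}
    (hu : u ∉ perp S) : ∑ z : S, (-1 : ℝ) ^ ((z : Vec n) ⬝ᵥ u).val = 0 := by
  obtain ⟨a, ha, hau⟩ : ∃ a ∈ S, u ⬝ᵥ a ≠ 0 := by
    by_contra! h
    exact hu h
  have hval : ((a ⬝ᵥ u : ZMod 2)).val = 1 := by
    rw [dotProduct_comm, (ne_zero_iff_eq_one _).1 hau]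
    rfl
  -- Translation by `a` flips the sign of every summand.
  have h : ∑ z : S, (-1 : ℝ) ^ ((z : Vec n) ⬝ᵥ u).val
      = -∑ z : S, (-1 : ℝ) ^ ((z : Vec n) ⬝ᵥ u).val := by
    rw [← Finset.sum_neg_distrib, ← Equiv.sum_comp (Equiv.addRight (⟨a, ha⟩ : S))]
    refine Finset.sum_congr rfl fun z _ => ?_
    simp only [Equiv.coe_addRight, Submodule.coe_add, add_dotProduct, neg_one_pow_val_add, hval]
    ring
  linarith

lemma qft_conjTranspose (n : ℕ) : (qft n)ᴴ = qft n := by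
  ext x y
  simp only [qft, Matrix.conjTranspose_apply, Matrix.of_apply, dotProduct_comm x y]
  exact Complex.conj_ofReal _

lemma qft_apply_mul_qft_apply {n : ℕ} (x y z : Vec n) :
    qft n x z * qft n z y = (((2 ^ n : ℝ)⁻¹ * (-1) ^ (z ⬝ᵥ (x + y)).val : ℝ) : ℂ) := by
  have h2 : (0 : ℝ) ≤ 2 ^ n := by positivity
  simp only [qft, Matrix.of_apply]
  rw [← Complex.ofReal_mul, div_mul_div_comm, Real.mul_self_sqrt h2, dotProduct_add,
    neg_one_pow_val_add, dotProduct_comm x z, div_eq_inv_mul]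

lemma mul_memberTest_true_apply {n : ℕ} (S : Submodule (ZMod 2) (Vec n)) (M : QOp n) (x z : Vec n)
    [Decidable (z ∈ S)] : (M * memberTest S true) x z = if z ∈ S then M x z else 0 := by
  rw [memberTest, Matrix.mul_diagonal]
  by_cases h : z ∈ S <;> simp [h]

/-- The entries of the projector onto the states whose Fourier transform is supported on `S`
vanish off the pairs of labels with difference in `S^⊥`. -/
lemma qft_conj_memberTest_apply_eq_zero {n : ℕ} (S : Submodule (ZMod 2) (Vec n)) {x y : Vec n}
    (h : x + y ∉ perp S) : ((qft n)ᴴ * memberTest S true * qft n) x y = 0 := by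
  classical
  rw [qft_conjTranspose, Matrix.mul_apply]
  simp_rw [mul_memberTest_true_apply, ite_mul, zero_mul, qft_apply_mul_qft_apply]
  rw [← Finset.sum_filter, ← Complex.ofReal_sum, ← Finset.mul_sum,
    Finset.sum_subtype (p := fun z => z ∈ S) _ (by simp)]
  rw [show (∑ z : {z // z ∈ S}, (-1 : ℝ) ^ ((z : Vec n) ⬝ᵥ (x + y)).val) = 0 from ?_]
  · simp
  · convert sum_character_eq_zero S h

lemma qft_isometry (n : ℕ) : (qft n)ᴴ * qft n = 1 := by
  classical
  ext x y
  rw [qft_conjTranspose, Matrix.mul_apply]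
  simp_rw [qft_apply_mul_qft_apply]
  rw [← Complex.ofReal_sum, ← Finset.mul_sum]
  by_cases hxy : x = y
  · subst hxy
    have : x + x = 0 := by
      funext i
      exact CharTwo.add_self_eq_zero (x i)
    simp [this]
  · have hne : x + y ∉ perp (⊤ : Submodule (ZMod 2) (Vec n)) := by
      intro h
      refine hxy (funext fun i => ?_)
      have := h (Pi.single i 1) trivial
      rw [dotProduct_single, mul_one, Pi.add_apply] at this
      exact CharTwo.add_eq_zero.1 this
    have h0 := sum_character_eq_zero _ hne
    rw [← Equiv.sum_comp (Submodule.topEquiv (R := ZMod 2) (M := Vec n)).toEquiv.symm] at h0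
    have h1 : ∑ z : Vec n, (-1 : ℝ) ^ (z ⬝ᵥ (x + y)).val = 0 := h0
    rw [h1, Matrix.one_apply_ne hxy]
    simp

lemma qft_mul_conjTranspose (n : ℕ) : qft n * (qft n)ᴴ = 1 :=
  mul_eq_one_comm.1 (qft_isometry n)

lemma memberTest_mulVec_apply {n : ℕ} (S : Submodule (ZMod 2) (Vec n)) (b : Bool) (ψ : QState n)
    (x : Vec n) [Decidable (x ∈ S ↔ b = true)] :
    (memberTest S b *ᵥ ψ) x = if (x ∈ S ↔ b = true) then ψ x else 0 := by
  rw [memberTest, Matrix.mulVec_diagonal]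
  split_ifs <;> simp

lemma sum_normSq_memberTest {n : ℕ} (S : Submodule (ZMod 2) (Vec n)) (ψ : QState n) :
    ∑ b : Bool, normSq (memberTest S b *ᵥ ψ) = normSq ψ := by
  classical
  unfold normSq
  rw [Finset.sum_comm]
  refine Finset.sum_congr rfl fun x _ => ?_
  simp only [memberTest_mulVec_apply, Fintype.sum_bool]
  by_cases hx : x ∈ S <;> simp [hx]

lemma memberTest_mul_of_le {n : ℕ} {S S' : Submodule (ZMod 2) (Vec n)} (h : S ≤ S') (b : Bool) :
    memberTest S' b * memberTest S true = if b = true then memberTest S true else 0 := by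
  classical
  simp only [memberTest, Matrix.diagonal_mul_diagonal]
  cases b
  · ext x y
    by_cases hxy : x = y
    · subst hxy
      by_cases hx : x ∈ S
      · simp [hx, h hx]
      · simp [hx]
    · simp [hxy]
  · ext x y
    by_cases hxy : x = y
    · subst hxy
      by_cases hx : x ∈ S
      · simp [hx, h hx]
      · simp [hx]
    · simp [hxy]

/-- The operators of the two consecutive tests of a verification: first membership of the label in
`S'`, with outcome `c.1`, then membership of the Fourier label in `S`, with outcome `c.2`. -/
noncomputable def testOp {n : ℕ} (S S' : Submodule (ZMod 2) (Vec n)) (c : Bool × Bool) : QOp n :=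
  (qft n)ᴴ * memberTest S c.2 * qft n * memberTest S' c.1

lemma verOp_eq_testOp {n : ℕ} (k : SVK n) (c : Bool × Bool) :
    verOp k c = testOp (perp k.1.span) (perp k.2.span) c := rfl

lemma normSq_testOp {n : ℕ} (S S' : Submodule (ZMod 2) (Vec n)) (c : Bool × Bool)
    (ψ : QState n) :
    normSq (testOp S S' c *ᵥ ψ)
      = normSq (memberTest S c.2 *ᵥ (qft n *ᵥ (memberTest S' c.1 *ᵥ ψ))) := by
  have hU : ((qft n)ᴴ)ᴴ * (qft n)ᴴ = 1 := by
    rw [Matrix.conjTranspose_conjTranspose, qft_mul_conjTranspose]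
  rw [testOp, ← Matrix.mulVec_mulVec, ← Matrix.mulVec_mulVec, ← Matrix.mulVec_mulVec,
    normSq_mulVec_of_isometry hU]

lemma sum_normSq_testOp {n : ℕ} (S S' : Submodule (ZMod 2) (Vec n)) (ψ : QState n) :
    ∑ c : Bool × Bool, normSq (testOp S S' c *ᵥ ψ) = normSq ψ := by
  rw [Fintype.sum_prod_type]
  simp_rw [normSq_testOp, sum_normSq_memberTest, normSq_mulVec_of_isometry (qft_isometry n),
    sum_normSq_memberTest]

lemma sum_normSq_onWires_testOp {n w : ℕ} (e : Fin n ↪ Fin w) (S S' : Submodule (ZMod 2) (Vec n))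
    (ψ : QState w) :
    ∑ c : Bool × Bool, normSq (onWires e (testOp S S' c) *ᵥ ψ) = normSq ψ := by
  simp_rw [normSq_onWires_mulVec]
  rw [Finset.sum_comm]
  simp_rw [sum_normSq_testOp, ← normSq_eq_sum_slice]

lemma perp_anti {n : ℕ} {S S' : Submodule (ZMod 2) (Vec n)} (h : S ≤ S') : perp S' ≤ perp S :=
  fun _ hx a ha => hx a (h ha)

/-- The verification with complete knowledge of `A`: membership of the label in `A^⊥⊥` (which is
`A`) and of the Fourier label in `A^⊥`. -/
noncomputable def idealOp {n : ℕ} (A : Submodule (ZMod 2) (Vec n)) (c : Bool × Bool) : QOp n :=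
  testOp (perp A) (perp (perp A)) c

/-- The two projectors of the ideal verification commute. -/
lemma idealOp_accept_comm {n : ℕ} (A : Submodule (ZMod 2) (Vec n)) :
    (qft n)ᴴ * memberTest (perp A) true * qft n * memberTest (perp (perp A)) true
      = memberTest (perp (perp A)) true * ((qft n)ᴴ * memberTest (perp A) true * qft n) := by
  classical
  ext x y
  conv_lhs => rw [memberTest, memberTest, Matrix.mul_diagonal]
  conv_rhs => rw [memberTest, memberTest, Matrix.diagonal_mul]
  rw [mul_comm]
  by_cases h : x + y ∈ perp (perp A)
  · have hxy : x ∈ perp (perp A) ↔ y ∈ perp (perp A) := by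
      refine ⟨fun hx => ?_, fun hy => ?_⟩
      · have := Submodule.sub_mem _ h hx
        rwa [add_sub_cancel_left] at this
      · have := Submodule.sub_mem _ h hy
        rwa [add_sub_cancel_right] at this
    simp only [hxy]
  · have := qft_conj_memberTest_apply_eq_zero (perp A) h
    rw [memberTest] at this
    rw [this, mul_zero, mul_zero]

/-- A state accepted by the ideal verification is accepted with certainty by every key whose
vectors lie in `A` and `A^⊥`. -/
lemma testOp_mul_idealOp_accept {n : ℕ} {A V W : Submodule (ZMod 2) (Vec n)} (hV : V ≤ A)
    (hW : W ≤ perp A) {d : Bool × Bool} (hd : d ≠ (true, true)) :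
    testOp (perp V) (perp W) d * idealOp A (true, true) = 0 := by
  set Q := qft n with hQ
  have h1 : testOp (perp V) (perp W) d * idealOp A (true, true)
      = Qᴴ * memberTest (perp V) d.2 * Q * ((memberTest (perp W) d.1
        * memberTest (perp (perp A)) true) * (Qᴴ * memberTest (perp A) true * Q)) := by
    simp only [idealOp, testOp]
    rw [idealOp_accept_comm]
    simp only [mul_assoc]
    rfl
  rw [h1, memberTest_mul_of_le (perp_anti hW)]
  obtain ⟨d1, d2⟩ := d
  cases d1
  · simp
  · cases d2
    · rw [if_pos rfl, ← idealOp_accept_comm]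
      have h2 : Qᴴ * memberTest (perp V) false * Q * (Qᴴ * memberTest (perp A) true * Q
            * memberTest (perp (perp A)) true)
          = Qᴴ * (memberTest (perp V) false * ((Q * Qᴴ) * memberTest (perp A) true)) * Q
            * memberTest (perp (perp A)) true := by
        simp only [mul_assoc]
      rw [h2, hQ, qft_mul_conjTranspose, one_mul, memberTest_mul_of_le (perp_anti hV)]
      simp
    · exact absurd rfl hd

/-- The distance between two pairs of consecutive tests, in terms of the distances between the
corresponding single tests. -/
lemma normSq_testOp_sub_le {n : ℕ} (S S' R R' : Submodule (ZMod 2) (Vec n)) (c : Bool × Bool)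
    (ψ : QState n) :
    normSq ((testOp S S' c - testOp R R' c) *ᵥ ψ)
      ≤ 2 * normSq ((memberTest S c.2 - memberTest R c.2) *ᵥ (qft n *ᵥ (memberTest S' c.1 *ᵥ ψ)))
        + 2 * normSq ((memberTest S' c.1 - memberTest R' c.1) *ᵥ ψ) := by
  have hsplit : (testOp S S' c - testOp R R' c) *ᵥ ψ
      = (qft n)ᴴ *ᵥ ((memberTest S c.2 - memberTest R c.2) *ᵥ
          (qft n *ᵥ (memberTest S' c.1 *ᵥ ψ)))
        + (qft n)ᴴ *ᵥ (memberTest R c.2 *ᵥ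
          (qft n *ᵥ ((memberTest S' c.1 - memberTest R' c.1) *ᵥ ψ))) := by
    simp only [Matrix.mulVec_mulVec, ← Matrix.add_mulVec, testOp]
    congr 1
    noncomm_ring
  have hU : ((qft n)ᴴ)ᴴ * (qft n)ᴴ = 1 := by
    rw [Matrix.conjTranspose_conjTranspose, qft_mul_conjTranspose]
  have hle : normSq (memberTest R c.2 *ᵥ
      (qft n *ᵥ ((memberTest S' c.1 - memberTest R' c.1) *ᵥ ψ)))
      ≤ normSq ((memberTest S' c.1 - memberTest R' c.1) *ᵥ ψ) := by
    rw [← normSq_mulVec_of_isometry (qft_isometry n)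
      ((memberTest S' c.1 - memberTest R' c.1) *ᵥ ψ), ← sum_normSq_memberTest R (qft n *ᵥ _)]
    exact Finset.single_le_sum
      (f := fun b => normSq (memberTest R b *ᵥ
        (qft n *ᵥ ((memberTest S' c.1 - memberTest R' c.1) *ᵥ ψ))))
      (fun b _ => normSq_nonneg _) (Finset.mem_univ c.2)
  rw [hsplit]
  refine (normSq_add_le one_pos _ _).trans ?_
  rw [normSq_mulVec_of_isometry hU, normSq_mulVec_of_isometry hU]
  rw [inv_one, one_add_one_eq_two]
  linarith

/-! ### Averages over independent uniform choices -/

/-- Resampling: drawing all values, and then redrawing those outside `s`, is the same as drawing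
all values once.  Hence an average may be bounded for fixed values on `s`. -/
lemma expect_le_of_piecewise {ι X : Type*} [Fintype ι] [DecidableEq ι] [Fintype X] [Nonempty X]
    (s : Finset ι) (f : (ι → X) → ℝ) (B : ℝ)
    (h : ∀ v₀ : ι → X, 𝔼 v : ι → X, f (s.piecewise v₀ v) ≤ B) : 𝔼 v : ι → X, f v ≤ B := by
  -- Exchanging the values outside `s` is an involution on pairs of functions.
  let swap : (ι → X) × (ι → X) → (ι → X) × (ι → X) :=
    fun p => (s.piecewise p.1 p.2, s.piecewise p.2 p.1)
  have hswap : Function.Involutive swap := by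
    rintro ⟨a, b⟩
    refine Prod.ext ?_ ?_ <;> funext i <;> by_cases hi : i ∈ s <;> simp [swap, hi]
  have h1 : 𝔼 p : (ι → X) × (ι → X), f (s.piecewise p.1 p.2)
      = 𝔼 p : (ι → X) × (ι → X), f p.1 :=
    Fintype.expect_equiv hswap.toPerm _ _ fun _ => rfl
  have h2 : 𝔼 p : (ι → X) × (ι → X), f p.1 = 𝔼 v : ι → X, f v := by
    rw [← Finset.univ_product_univ, Finset.expect_product]
    simp
  have h3 : 𝔼 p : (ι → X) × (ι → X), f (s.piecewise p.1 p.2)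
      = 𝔼 v₀ : ι → X, 𝔼 v : ι → X, f (s.piecewise v₀ v) := by
    rw [← Finset.univ_product_univ, Finset.expect_product]
  rw [← h2, ← h1, h3]
  exact Finset.expect_le Finset.univ_nonempty fun v₀ _ => h v₀

lemma expect_apply_eq {ι X : Type*} [Fintype ι] [DecidableEq ι] [Fintype X] [Nonempty X]
    (i : ι) (g : X → ℝ) : 𝔼 v : ι → X, g (v i) = 𝔼 x, g x := by
  rw [Fintype.expect_equiv (Equiv.funSplitAt i X) (fun v => g (v i)) (fun p => g p.1)
    fun v => by simp, ← Finset.univ_product_univ, Finset.expect_product]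
  simp

/-- A vector outside `B^⊥` is orthogonal to exactly half of `B`. -/
lemma sum_orthogonal_eq {n : ℕ} (B : Submodule (ZMod 2) (Vec n)) {x : Vec n} (hx : x ∉ perp B) :
    ∑ b : B, (if x ⬝ᵥ (b : Vec n) = 0 then (1 : ℝ) else 0) = Fintype.card B / 2 := by
  have h : ∀ b : B, (if x ⬝ᵥ (b : Vec n) = 0 then (1 : ℝ) else 0)
      = 1 / 2 + 1 / 2 * (-1) ^ ((b : Vec n) ⬝ᵥ x).val := by
    intro b
    rw [dotProduct_comm]
    split_ifs with h0
    · rw [h0]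
      norm_num
    · rw [(ne_zero_iff_eq_one _).1 h0, ZMod.val_one]
      norm_num
  simp_rw [h]
  rw [Finset.sum_add_distrib, ← Finset.mul_sum, sum_character_eq_zero B hx]
  simp [div_eq_mul_inv]

/-- A fixed vector outside `B^⊥` is orthogonal to all of `k` independent uniform elements of `B`
with probability `2 ^ (-k)`. -/
lemma expect_forall_orthogonal {n : ℕ} {ι : Type*} [Fintype ι] [DecidableEq ι]
    (B : Submodule (ZMod 2) (Vec n)) {x : Vec n} (hx : x ∉ perp B) (T : Finset ι) :
    𝔼 w : ι → B, (if ∀ j ∈ T, x ⬝ᵥ (w j : Vec n) = 0 then (1 : ℝ) else 0)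
      = (1 / 2) ^ T.card := by
  have hprod : ∀ w : ι → B, (if ∀ j ∈ T, x ⬝ᵥ (w j : Vec n) = 0 then (1 : ℝ) else 0)
      = ∏ j, if j ∈ T then (if x ⬝ᵥ (w j : Vec n) = 0 then (1 : ℝ) else 0) else 1 := by
    intro w
    rw [Finset.prod_ite_mem, Finset.univ_inter, Finset.prod_boole]
    congr
  have hcard : (0 : ℝ) < Fintype.card B := by exact_mod_cast Fintype.card_pos
  rw [Fintype.expect_eq_sum_div_card]
  simp_rw [hprod]
  rw [← Fintype.piFinset_univ, ← Finset.prod_univ_sum (fun _ => Finset.univ)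
    (fun j (b : B) => if j ∈ T then (if x ⬝ᵥ (b : Vec n) = 0 then (1 : ℝ) else 0) else 1)]
  rw [Fintype.card_fun, Nat.cast_pow, ← Finset.card_univ (α := ι), ← Finset.prod_const,
    ← Finset.prod_div_distrib]
  have : ∀ j : ι, (∑ b : B, if j ∈ T then (if x ⬝ᵥ (b : Vec n) = 0 then (1 : ℝ) else 0) else 1)
      / Fintype.card B = if j ∈ T then 1 / 2 else 1 := by
    intro j
    split_ifs
    · rw [sum_orthogonal_eq B hx]
      field_simp
    · rw [Finset.sum_const, Finset.card_univ, nsmul_eq_mul, mul_one, div_self hcard.ne']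
  simp_rw [this]
  rw [Finset.prod_ite_mem, Finset.univ_inter, Finset.prod_const]

/-- On a state that does not depend on the sampled vectors `w j`, testing orthogonality to a
subspace of `B` that contains the `w j` with `j ∈ T` is close to testing orthogonality to `B`. -/
lemma expect_normSq_memberTest_sub_le {n : ℕ} {ι : Type*} [Fintype ι] [DecidableEq ι]
    (B : Submodule (ZMod 2) (Vec n)) (T : Finset ι)
    (K : (ι → B) → Submodule (ZMod 2) (Vec n)) (hK : ∀ w, K w ≤ B)
    (hT : ∀ w, ∀ j ∈ T, (w j : Vec n) ∈ K w) (b : Bool) (φ : QState n) :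
    𝔼 w : ι → B, normSq ((memberTest (perp (K w)) b - memberTest (perp B) b) *ᵥ φ)
      ≤ (1 / 2) ^ T.card * normSq φ := by
  classical
  unfold normSq
  rw [Finset.expect_sum_comm, Finset.mul_sum]
  refine Finset.sum_le_sum fun x _ => ?_
  have happ : ∀ w, ((memberTest (perp (K w)) b - memberTest (perp B) b) *ᵥ φ) x
      = (if (x ∈ perp (K w) ↔ b = true) then φ x else 0)
        - (if (x ∈ perp B ↔ b = true) then φ x else 0) := by
    intro w
    rw [Matrix.sub_mulVec, Pi.sub_apply, memberTest_mulVec_apply, memberTest_mulVec_apply]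
  simp_rw [happ]
  by_cases hx : x ∈ perp B
  · have h0 : ∀ w, x ∈ perp (K w) := fun w => perp_anti (hK w) hx
    rw [Finset.expect_eq_zero fun w _ => by simp [hx, h0]]
    positivity
  · rw [← expect_forall_orthogonal B hx T, Finset.expect_mul]
    refine Finset.expect_le_expect fun w _ => ?_
    by_cases hxK : x ∈ perp (K w)
    · rw [if_pos fun j hj => hxK _ (hT w j hj), one_mul]
      cases b <;> simp [hx, hxK]
    · simp only [hx, hxK, sub_self, norm_zero, ne_eq, OfNat.ofNat_ne_zero, not_false_eq_true,
        zero_pow]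
      positivity

/-- Each of `t` uniform samples lies in `S` or repeats an earlier sample with probability at most
`3 / 4`, and otherwise halves the quantity averaged here, whence the factor
`3 / 4 + 1 / 4 * (1 / 2) = 7 / 8` per sample. -/
lemma expect_half_pow_card_sdiff_le {m : ℕ} (S : Finset (Fin m)) (t : ℕ)
    (h : 4 * (S.card + t) ≤ 3 * m) :
    𝔼 f : Fin t → Fin m, (1 / 2 : ℝ) ^ (Finset.univ.image f \ S).card ≤ (7 / 8) ^ t := by
  induction t with
  | zero => simp
  | succ t ih =>
    have hm : 0 < m := by omega
    have hm' : (0 : ℝ) < m := by exact_mod_cast hm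
    have : Nonempty (Fin m) := ⟨⟨0, hm⟩⟩
    rw [← Fintype.expect_equiv (Fin.consEquiv fun _ : Fin (t + 1) => Fin m)
      (fun p => (1 / 2 : ℝ) ^ (Finset.univ.image (Fin.cons p.1 p.2 : Fin (t + 1) → Fin m) \ S).card)
      _ fun p => rfl, ← Finset.univ_product_univ, Finset.expect_product, Finset.expect_comm]
    have hstep : ∀ f : Fin t → Fin m,
        𝔼 a : Fin m, (1 / 2 : ℝ) ^
            (Finset.univ.image (Fin.cons a f : Fin (t + 1) → Fin m) \ S).card
          ≤ 7 / 8 * (1 / 2 : ℝ) ^ (Finset.univ.image f \ S).card := by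
      intro f
      set U := Finset.univ.image f with hU
      have himg : ∀ a, Finset.univ.image (Fin.cons a f : Fin (t + 1) → Fin m) = insert a U := by
        intro a
        ext b
        simp [hU, Fin.exists_fin_succ, eq_comm]
      have hval : ∀ a, (1 / 2 : ℝ) ^ (insert a U \ S).card
          = (1 / 2 + 1 / 2 * if a ∈ S ∪ U then 1 else 0) * (1 / 2 : ℝ) ^ (U \ S).card := by
        intro a
        by_cases haS : a ∈ S
        · rw [Finset.insert_sdiff_of_mem _ haS, if_pos (Finset.mem_union_left _ haS)]
          ring
        · by_cases haU : a ∈ U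
          · rw [Finset.insert_eq_of_mem haU, if_pos (Finset.mem_union_right _ haU)]
            ring
          · rw [Finset.insert_sdiff_of_notMem _ haS, Finset.card_insert_of_notMem (by simp [haU]),
              if_neg (by simp [haS, haU]), pow_succ]
            ring
      simp_rw [himg, hval]
      rw [← Finset.expect_mul]
      refine mul_le_mul_of_nonneg_right ?_ (by positivity)
      rw [Finset.expect_add_distrib, ← Finset.mul_expect, Fintype.expect_const,
        Fintype.expect_eq_sum_div_card, Finset.sum_boole, Fintype.card_fin,
        Finset.filter_univ_mem]
      have hc : ((S ∪ U).card : ℝ) ≤ 3 / 4 * m := by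
        have h1 : (S ∪ U).card ≤ S.card + t :=
          (Finset.card_union_le _ _).trans (Nat.add_le_add_left
            (Finset.card_image_le.trans (by simp)) _)
        have h2 : 4 * (S ∪ U).card ≤ 3 * m := by omega
        have h3 : (4 : ℝ) * (S ∪ U).card ≤ 3 * m := by exact_mod_cast h2
        linarith
      have := (div_le_iff₀ hm').2 hc
      linarith
    refine (Finset.expect_le_expect fun f _ => hstep f).trans ?_
    rw [← Finset.mul_expect, pow_succ']
    exact mul_le_mul_of_nonneg_left (ih (by omega)) (by norm_num)

/-! ### The hybrid argument -/

namespace Adversary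

variable {p : Params} {G : GateSet}

lemma gate_isometry (g : Fin G.card) :
    (G.gate g : QOp (G.arity g))ᴴ * (G.gate g : QOp (G.arity g)) = 1 :=
  Matrix.mem_unitaryGroup_iff'.1 (G.gate g).2

lemma winProb_nonneg (msk : MSK p) {w : ℕ} (adv : Adversary p G w) (ψ : QState w) :
    0 ≤ adv.winProb msk ψ := by
  induction adv with
  | gate g e next ih => exact ih _
  | measure i next ih => exact Finset.sum_nonneg fun b _ => ih b _
  | franchise j next ih => exact ih _ _
  | mint next ih => exact ih _
  | verify id e next ih => exact Finset.sum_nonneg fun c _ => ih _ _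
  | challenge id₁ id₂ hne e =>
    refine Finset.sum_nonneg fun c _ => Finset.sum_nonneg fun d _ => ?_
    split_ifs
    · exact normSq_nonneg _
    · exact le_rfl

lemma winProb_le_normSq (msk : MSK p) {w : ℕ} (adv : Adversary p G w) (ψ : QState w) :
    adv.winProb msk ψ ≤ normSq ψ := by
  induction adv with
  | gate g e next ih => exact (ih _).trans_eq (normSq_onWires_isometry e (gate_isometry g) ψ)
  | measure i next ih =>
    exact (Finset.sum_le_sum fun b _ => ih b _).trans_eq (sum_normSq_bitProj i ψ)
  | franchise j next ih => exact ih _ _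
  | mint next ih =>
    exact (ih _).trans_eq (by rw [normSq_tensor, FQM.mint, normSq_subspaceState, mul_one])
  | verify id e next ih =>
    exact (Finset.sum_le_sum fun c _ => ih _ _).trans_eq (sum_normSq_onWires_testOp e _ _ ψ)
  | challenge id₁ id₂ hne e =>
    calc _ ≤ ∑ c : Bool × Bool, ∑ d : Bool × Bool,
          normSq (onWires e (verOp (honestKey msk id₂) d) *ᵥ
            (onWires e (verOp (honestKey msk id₁) c) *ᵥ ψ)) := by
          refine Finset.sum_le_sum fun c _ => Finset.sum_le_sum fun d _ => ?_
          split_ifs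
          · exact le_rfl
          · exact normSq_nonneg _
      _ = normSq ψ := by
          simp_rw [verOp_eq_testOp, sum_normSq_onWires_testOp]

/-- The winning probability is a sum of squared norms of linear images of the state, hence is
subadditive in the same sense as the squared norm. -/
lemma winProb_add_le (msk : MSK p) {δ : ℝ} (hδ : 0 < δ) {w : ℕ} (adv : Adversary p G w)
    (ψ φ : QState w) :
    adv.winProb msk (ψ + φ) ≤ (1 + δ) * adv.winProb msk ψ + (1 + δ⁻¹) * adv.winProb msk φ := by
  induction adv with
  | gate g e next ih =>
    simp only [winProb, Matrix.mulVec_add]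
    exact ih _ _
  | measure i next ih =>
    simp only [winProb, Matrix.mulVec_add]
    rw [Finset.mul_sum, Finset.mul_sum, ← Finset.sum_add_distrib]
    exact Finset.sum_le_sum fun b _ => ih b _ _
  | franchise j next ih => exact ih _ _ _
  | mint next ih =>
    simp only [winProb, tensor_add]
    exact ih _ _
  | verify id e next ih =>
    simp only [winProb, Matrix.mulVec_add]
    rw [Finset.mul_sum, Finset.mul_sum, ← Finset.sum_add_distrib]
    exact Finset.sum_le_sum fun c _ => ih _ _ _
  | challenge id₁ id₂ hne e =>
    simp only [winProb, Matrix.mulVec_add]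
    rw [Finset.mul_sum, Finset.mul_sum, ← Finset.sum_add_distrib]
    refine Finset.sum_le_sum fun c _ => ?_
    rw [Finset.mul_sum, Finset.mul_sum, ← Finset.sum_add_distrib]
    refine Finset.sum_le_sum fun d _ => ?_
    split_ifs
    · exact normSq_add_le hδ _ _
    · simp

end Adversary

lemma span_honestKey_fst_le {p : Params} (msk : MSK p) (id : Honest p) :
    (honestKey msk id).1.span ≤ msk.A.1 := by
  refine Submodule.span_le.2 ?_
  rintro _ ⟨i, rfl⟩
  exact (msk.v i).2

lemma span_honestKey_snd_le {p : Params} (msk : MSK p) (id : Honest p) :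
    (honestKey msk id).2.span ≤ perp msk.A.1 := by
  refine Submodule.span_le.2 ?_
  rintro _ ⟨i, rfl⟩
  exact (msk.w i).2

lemma verOp_mul_idealOp_accept {p : Params} (msk : MSK p) (id : Honest p) {d : Bool × Bool}
    (hd : d ≠ (true, true)) :
    verOp (honestKey msk id) d * idealOp msk.A.1 (true, true) = 0 :=
  testOp_mul_idealOp_accept (span_honestKey_fst_le msk id) (span_honestKey_snd_le msk id) hd

/-- The bound on the winning probability after `k` steps: each step of the hybrid argument loses a
factor `1 + δ` and adds `(1 + δ⁻¹) * ε`. -/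
noncomputable def hybridBound (δ ε : ℝ) (k : ℕ) : ℝ := k * (1 + δ) ^ k * ((1 + δ⁻¹) * ε)

lemma hybridBound_succ_ge {δ ε : ℝ} (hδ : 0 < δ) (hε : 0 ≤ ε) (k : ℕ) :
    (1 + δ) * hybridBound δ ε k + (1 + δ⁻¹) * ε ≤ hybridBound δ ε (k + 1) := by
  have h1 : 1 ≤ (1 + δ) ^ (k + 1) := one_le_pow₀ (by linarith)
  have h2 : 0 ≤ (1 + δ⁻¹) * ε := by positivity
  unfold hybridBound
  push_cast
  rw [pow_succ] at *
  nlinarith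

lemma hybridBound_nonneg {δ ε : ℝ} (hδ : 0 < δ) (hε : 0 ≤ ε) (k : ℕ) :
    0 ≤ hybridBound δ ε k := by
  unfold hybridBound
  positivity

lemma hybridBound_le_succ {δ ε : ℝ} (hδ : 0 < δ) (hε : 0 ≤ ε) (k : ℕ) :
    hybridBound δ ε k ≤ hybridBound δ ε (k + 1) := by
  refine le_trans ?_ (hybridBound_succ_ge hδ hε k)
  have h1 := hybridBound_nonneg hδ hε k
  have h2 : 0 ≤ (1 + δ⁻¹) * ε := by positivity
  nlinarith

/-- A closeness bound for operators on `k` qubits carries over to their action on `k` qubits of a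
larger register. -/
lemma expect_sum_normSq_onWires_le {Ω ι : Type*} [Fintype Ω] [Fintype ι] {k w : ℕ}
    (e : Fin k ↪ Fin w) (M : Ω → ι → QOp k) {ε : ℝ}
    (hM : ∀ φ : QState k, 𝔼 o, ∑ c, normSq (M o c *ᵥ φ) ≤ ε * normSq φ) (ψ : QState w) :
    𝔼 o, ∑ c, normSq (onWires e (M o c) *ᵥ ψ) ≤ ε * normSq ψ := by
  simp_rw [normSq_onWires_mulVec]
  rw [normSq_eq_sum_slice e, Finset.mul_sum]
  calc _ = ∑ r, 𝔼 o, ∑ c, normSq (M o c *ᵥ slice e r ψ) := by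
        rw [← Finset.expect_sum_comm]
        exact Finset.expect_congr rfl fun o _ => Finset.sum_comm
    _ ≤ _ := Finset.sum_le_sum fun r _ => hM _

/-- The hybrid argument.  Everything the adversary sees except the honest keys is fixed, and the
honest verifications are close, on average over the honest keys, to the ideal one.  Replacing
them by the ideal one, from the first to the last, makes the state independent of the honest keys
up to each verification; and the state left by an ideal verification that accepts passes every
honest verification. -/
lemma expect_winProb_le {p : Params} {G : GateSet} {Ω : Type*} [Fintype Ω] [Nonempty Ω]
    (msk : Ω → MSK p) (A : HalfSubspace p.n) (hA : ∀ o, (msk o).A = A)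
    (key : Fin p.C → SVK p.n) (hkey : ∀ o j, colluderKey (msk o) j = key j)
    {δ ε : ℝ} (hδ : 0 < δ) (hε : 0 ≤ ε)
    (hclose : ∀ (id : Honest p) (φ : QState p.n), 𝔼 o, ∑ c : Bool × Bool,
      normSq ((verOp (honestKey (msk o) id) c - idealOp A.1 c) *ᵥ φ) ≤ ε * normSq φ)
    {w : ℕ} (adv : Adversary p G w) (ψ : QState w) {k : ℕ} (hk : adv.time ≤ k) :
    𝔼 o, adv.winProb (msk o) ψ ≤ hybridBound δ ε k * normSq ψ := by
  have hsplit : ∀ {w : ℕ} (e : Fin p.n ↪ Fin w) (id : Honest p) (c : Bool × Bool) (o : Ω)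
      (ψ : QState w), onWires e (verOp (honestKey (msk o) id) c) *ᵥ ψ
        = onWires e (idealOp A.1 c) *ᵥ ψ
          + onWires e (verOp (honestKey (msk o) id) c - idealOp A.1 c) *ᵥ ψ := by
    intro w e id c o ψ
    rw [← onWires_add_mulVec, add_sub_cancel]
  induction adv generalizing k with
  | gate g e next ih =>
    simp only [Adversary.time] at hk
    simp only [Adversary.winProb]
    have := ih (onWires e (G.gate g : QOp (G.arity g)) *ᵥ ψ) (k := k) (by omega)
    rwa [normSq_onWires_isometry e (Adversary.gate_isometry g)] at this
  | measure i next ih =>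
    simp only [Adversary.time] at hk
    simp only [Adversary.winProb]
    rw [Finset.expect_sum_comm, ← sum_normSq_bitProj i ψ, Finset.mul_sum]
    refine Finset.sum_le_sum fun b _ => ih b _ ?_
    have := Finset.le_sup (f := fun b => (next b).time) (Finset.mem_univ b)
    omega
  | franchise j next ih =>
    simp only [Adversary.time] at hk
    simp only [Adversary.winProb, hkey]
    refine ih _ _ ?_
    have := Finset.le_sup (f := fun s => (next s).time) (Finset.mem_univ (key j))
    omega
  | mint next ih =>
    simp only [Adversary.time] at hk
    simp only [Adversary.winProb, FQM.mint, hA]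
    have := ih (tensor ψ (subspaceState A.1)) (k := k) (by omega)
    rwa [normSq_tensor, normSq_subspaceState, mul_one] at this
  | verify id e next ih =>
    simp only [Adversary.time] at hk
    obtain ⟨k, rfl⟩ : ∃ k', k = k' + 1 := ⟨k - 1, by omega⟩
    have hnext : ∀ b, (next b).time ≤ k := by
      intro b
      have := Finset.le_sup (f := fun b => (next b).time) (Finset.mem_univ b)
      omega
    have hpoint : ∀ o, (Adversary.verify id e next).winProb (msk o) ψ
        ≤ (1 + δ) * (∑ c : Bool × Bool,
            (next (accepts c)).winProb (msk o) (onWires e (idealOp A.1 c) *ᵥ ψ))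
          + (1 + δ⁻¹) * ∑ c : Bool × Bool,
            normSq (onWires e (verOp (honestKey (msk o) id) c - idealOp A.1 c) *ᵥ ψ) := by
      intro o
      simp only [Adversary.winProb]
      rw [Finset.mul_sum, Finset.mul_sum, ← Finset.sum_add_distrib]
      refine Finset.sum_le_sum fun c _ => ?_
      rw [hsplit]
      -- The ideal part is continued with real verifications, to which the induction hypothesis
      -- applies; the winning probability from the difference is at most its squared norm.
      refine (Adversary.winProb_add_le _ hδ _ _ _).trans ?_
      gcongr
      exact Adversary.winProb_le_normSq _ _ _
    refine (Finset.expect_le_expect fun o _ => hpoint o).trans ?_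
    rw [Finset.expect_add_distrib, ← Finset.mul_expect, ← Finset.mul_expect,
      Finset.expect_sum_comm]
    have h1 : ∑ c : Bool × Bool, 𝔼 o, (next (accepts c)).winProb (msk o)
        (onWires e (idealOp A.1 c) *ᵥ ψ) ≤ hybridBound δ ε k * normSq ψ := by
      rw [← sum_normSq_onWires_testOp e (perp A.1) (perp (perp A.1)) ψ, Finset.mul_sum]
      exact Finset.sum_le_sum fun c _ => ih _ _ (hnext _)
    have h2 := expect_sum_normSq_onWires_le e _ (hclose id) ψ
    calc _ ≤ (1 + δ) * (hybridBound δ ε k * normSq ψ) + (1 + δ⁻¹) * (ε * normSq ψ) := by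
          gcongr
      _ = ((1 + δ) * hybridBound δ ε k + (1 + δ⁻¹) * ε) * normSq ψ := by ring
      _ ≤ _ := mul_le_mul_of_nonneg_right (hybridBound_succ_ge hδ hε k) (normSq_nonneg ψ)
  | challenge id₁ id₂ hne e =>
    simp only [Adversary.time] at hk
    obtain ⟨k, rfl⟩ : ∃ k', k = k' + 1 := ⟨k - 1, by omega⟩
    have hpoint : ∀ o, (Adversary.challenge (G := G) id₁ id₂ hne e).winProb (msk o) ψ
        ≤ (1 + δ⁻¹) * ∑ c : Bool × Bool,
          normSq (onWires e (verOp (honestKey (msk o) id₁) c - idealOp A.1 c) *ᵥ ψ) := by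
      intro o
      simp only [Adversary.winProb]
      rw [Finset.mul_sum]
      refine Finset.sum_le_sum fun c _ => ?_
      by_cases hc : c = (true, true)
      · subst hc
        -- The ideal part of the accepted state never fails the second verification, so only the
        -- difference between the first verification and the ideal one contributes.
        rw [← sum_normSq_onWires_testOp e (perp (honestKey (msk o) id₂).1.span)
          (perp (honestKey (msk o) id₂).2.span), Finset.mul_sum]
        refine Finset.sum_le_sum fun d _ => ?_
        have h0 : 0 ≤ (1 + δ⁻¹) * normSq (onWires e (testOp (perp (honestKey (msk o) id₂).1.span)
            (perp (honestKey (msk o) id₂).2.span) d) *ᵥ (onWires e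
              (verOp (honestKey (msk o) id₁) (true, true) - idealOp A.1 (true, true)) *ᵥ ψ)) :=
          mul_nonneg (by positivity) (normSq_nonneg _)
        split_ifs with hd
        · have hd' : d ≠ (true, true) := by
            rintro rfl
            exact absurd hd.2 (by decide)
          have hzero : onWires e (verOp (honestKey (msk o) id₂) d) *ᵥ
              (onWires e (idealOp A.1 (true, true)) *ᵥ ψ) = 0 := by
            rw [← onWires_mul_mulVec, ← hA o, verOp_mul_idealOp_accept _ _ hd',
              onWires_zero_mulVec]
          rw [hsplit e id₁, Matrix.mulVec_add, hzero]
          refine (normSq_add_le hδ _ _).trans_eq ?_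
          rw [normSq_zero, mul_zero, zero_add]
          rfl
        · exact h0
      · have hacc : accepts c = false := by
          revert c
          decide
        simp only [hacc, Bool.false_eq_true, false_and, if_false, Finset.sum_const_zero]
        exact mul_nonneg (by positivity) (normSq_nonneg _)
    refine (Finset.expect_le_expect fun o _ => hpoint o).trans ?_
    rw [← Finset.mul_expect]
    have h2 := expect_sum_normSq_onWires_le e _ (hclose id₁) ψ
    have h3 := hybridBound_nonneg hδ hε k
    calc _ ≤ (1 + δ⁻¹) * (ε * normSq ψ) := by gcongr
      _ ≤ ((1 + δ) * hybridBound δ ε k + (1 + δ⁻¹) * ε) * normSq ψ := by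
          rw [← mul_assoc]
          refine mul_le_mul_of_nonneg_right ?_ (normSq_nonneg ψ)
          have : 0 ≤ (1 + δ) * hybridBound δ ε k := by positivity
          linarith
      _ ≤ _ := mul_le_mul_of_nonneg_right (hybridBound_succ_ge hδ hε k) (normSq_nonneg ψ)

/-! ### Closeness of honest keys to the ideal verification -/

/-- The indices contained in the keys that the adversary can obtain. -/
def colluderIndices (p : Params) (I : Fin p.N → Fin p.t → Fin (p.n / 2)) :
    Finset (Fin (p.n / 2)) :=
  Finset.univ.biUnion fun j : Fin p.C => Finset.univ.image (I ⟨p.N - p.C + j, by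
    have h : p.C ≤ p.N := p.collusion_le
    have hj := j.isLt
    omega⟩)

/-- The indices in the key of an honest user that are in none of the keys that the adversary can
obtain. -/
def freshIndices (p : Params) (I : Fin p.N → Fin p.t → Fin (p.n / 2)) (id : Honest p) :
    Finset (Fin (p.n / 2)) :=
  Finset.univ.image (I (Fin.castLE (Nat.sub_le _ _) id)) \ colluderIndices p I

/-- The half key with the indices listed by `f`, where `v` lists all vectors. -/
def halfKey {n t : ℕ} {B : Submodule (ZMod 2) (Vec n)} (f : Fin t → Fin (n / 2))
    (v : Fin (n / 2) → B) : HalfKey n :=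
  ⟨Finset.univ.image f, fun i => (v i : Vec n)⟩

lemma span_halfKey_le {n t : ℕ} {B : Submodule (ZMod 2) (Vec n)} (f : Fin t → Fin (n / 2))
    (v : Fin (n / 2) → B) : (halfKey f v).span ≤ B := by
  refine Submodule.span_le.2 ?_
  rintro _ ⟨i, rfl⟩
  exact (v i).2

lemma mem_span_halfKey {n t : ℕ} {B : Submodule (ZMod 2) (Vec n)} (f : Fin t → Fin (n / 2))
    (v : Fin (n / 2) → B) {i : Fin (n / 2)} (hi : i ∈ Finset.univ.image f) :
    (v i : Vec n) ∈ (halfKey f v).span :=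
  Submodule.subset_span ⟨⟨i, hi⟩, rfl⟩

lemma halfKey_piecewise {n t : ℕ} {B : Submodule (ZMod 2) (Vec n)} (f : Fin t → Fin (n / 2))
    {S : Finset (Fin (n / 2))} (hf : Finset.univ.image f ⊆ S) (v₀ v : Fin (n / 2) → B) :
    halfKey f (S.piecewise v₀ v) = halfKey f v₀ := by
  refine congrArg (Sigma.mk _) (funext fun i => ?_)
  rw [Finset.piecewise_eq_of_mem _ _ _ (hf i.2)]

lemma expect_normSq_halfKey_sub_le {n t : ℕ} (B : Submodule (ZMod 2) (Vec n))
    (f : Fin t → Fin (n / 2)) (S : Finset (Fin (n / 2))) (v₀ : Fin (n / 2) → B) (b : Bool)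
    (φ : QState n) :
    𝔼 v : Fin (n / 2) → B, normSq ((memberTest (perp (halfKey f (S.piecewise v₀ v)).span) b
        - memberTest (perp B) b) *ᵥ φ)
      ≤ (1 / 2) ^ (Finset.univ.image f \ S).card * normSq φ := by
  refine expect_normSq_memberTest_sub_le B _ (fun v => (halfKey f (S.piecewise v₀ v)).span)
    (fun v => span_halfKey_le _ _) (fun v j hj => ?_) b φ
  rw [Finset.mem_sdiff] at hj
  have := mem_span_halfKey f (S.piecewise v₀ v) hj.1
  rwa [Finset.piecewise_eq_of_notMem _ _ _ hj.2] at this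

lemma normSq_memberTest_le {n : ℕ} (S : Submodule (ZMod 2) (Vec n)) (b : Bool) (φ : QState n) :
    normSq (memberTest S b *ᵥ φ) ≤ normSq φ := by
  rw [← sum_normSq_memberTest S φ]
  exact Finset.single_le_sum (f := fun b => normSq (memberTest S b *ᵥ φ))
    (fun b _ => normSq_nonneg _) (Finset.mem_univ b)

/-- With the colluders' vectors fixed and all others redrawn, an honest verification is close to
the ideal one on every fixed state. -/
lemma expect_normSq_verOp_sub_le {p : Params} (A : HalfSubspace p.n)
    (I J : Fin p.N → Fin p.t → Fin (p.n / 2)) (v₀ : Fin (p.n / 2) → A.1)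
    (w₀ : Fin (p.n / 2) → perp A.1) (id : Honest p) (φ : QState p.n) :
    𝔼 o : (Fin (p.n / 2) → A.1) × (Fin (p.n / 2) → perp A.1), ∑ c : Bool × Bool,
        normSq ((verOp (honestKey (⟨A, I, J, (colluderIndices p I).piecewise v₀ o.1,
          (colluderIndices p J).piecewise w₀ o.2⟩ : MSK p) id) c - idealOp A.1 c) *ᵥ φ)
      ≤ 8 * ((1 / 2) ^ (freshIndices p I id).card + (1 / 2) ^ (freshIndices p J id).card)
        * normSq φ := by
  set i₀ : Fin p.N := Fin.castLE (Nat.sub_le _ _) id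
  let V := fun v : Fin (p.n / 2) → A.1 =>
    perp (halfKey (I i₀) ((colluderIndices p I).piecewise v₀ v)).span
  let W := fun w : Fin (p.n / 2) → perp A.1 =>
    perp (halfKey (J i₀) ((colluderIndices p J).piecewise w₀ w)).span
  have hV : ∀ (w : Fin (p.n / 2) → perp A.1) (c : Bool × Bool), 𝔼 v : Fin (p.n / 2) → A.1,
      normSq ((memberTest (V v) c.2 - memberTest (perp A.1) c.2) *ᵥ
        (qft p.n *ᵥ (memberTest (W w) c.1 *ᵥ φ)))
      ≤ (1 / 2) ^ (freshIndices p I id).card * normSq φ := by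
    intro w c
    refine (expect_normSq_halfKey_sub_le A.1 (I i₀) (colluderIndices p I) v₀ c.2 _).trans ?_
    rw [normSq_mulVec_of_isometry (qft_isometry p.n)]
    exact mul_le_mul_of_nonneg_left (normSq_memberTest_le _ _ _) (by positivity)
  have hW : ∀ c : Bool × Bool, 𝔼 w : Fin (p.n / 2) → perp A.1,
      normSq ((memberTest (W w) c.1 - memberTest (perp (perp A.1)) c.1) *ᵥ φ)
      ≤ (1 / 2) ^ (freshIndices p J id).card * normSq φ := fun c =>
    expect_normSq_halfKey_sub_le (perp A.1) (J i₀) (colluderIndices p J) w₀ c.1 φ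
  rw [Finset.expect_sum_comm]
  have hc : ∀ c : Bool × Bool, 𝔼 o : (Fin (p.n / 2) → A.1) × (Fin (p.n / 2) → perp A.1),
        normSq ((verOp (honestKey (⟨A, I, J, (colluderIndices p I).piecewise v₀ o.1,
          (colluderIndices p J).piecewise w₀ o.2⟩ : MSK p) id) c - idealOp A.1 c) *ᵥ φ)
      ≤ 2 * ((1 / 2) ^ (freshIndices p I id).card * normSq φ)
        + 2 * ((1 / 2) ^ (freshIndices p J id).card * normSq φ) := by
    intro c
    refine (Finset.expect_le_expect fun o _ =>
      normSq_testOp_sub_le (V o.1) (W o.2) (perp A.1) (perp (perp A.1)) c φ).trans ?_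
    rw [Finset.expect_add_distrib, ← Finset.mul_expect, ← Finset.mul_expect,
      ← Finset.univ_product_univ, Finset.expect_product, Finset.expect_product,
      Finset.expect_comm]
    gcongr
    · exact Finset.expect_le Finset.univ_nonempty fun w _ => hV w c
    · exact Finset.expect_le Finset.univ_nonempty fun _ _ => hW c
  refine (Finset.sum_le_sum fun c _ => hc c).trans_eq ?_
  rw [Finset.sum_const, Finset.card_univ]
  simp only [Fintype.card_prod, Fintype.card_bool]
  rw [nsmul_eq_mul]
  push_cast
  ring

/-- A bound on the distance of the honest verifications from the ideal one, for given indices.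
The factor `8` is `4` (pairs of outcomes) times `2` (splitting off each of the two tests); the sum
over all users dominates the error of the user chosen adaptively by the adversary. -/
noncomputable def keyError (p : Params) (I J : Fin p.N → Fin p.t → Fin (p.n / 2)) : ℝ :=
  8 * ∑ id : Honest p, ((1 / 2 : ℝ) ^ (freshIndices p I id).card
    + (1 / 2) ^ (freshIndices p J id).card)

lemma keyError_nonneg (p : Params) (I J : Fin p.N → Fin p.t → Fin (p.n / 2)) :
    0 ≤ keyError p I J := by
  unfold keyError
  positivity

lemma image_subset_colluderIndices (p : Params) (I : Fin p.N → Fin p.t → Fin (p.n / 2))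
    (j : Fin p.C) (h : p.N - p.C + j < p.N) :
    Finset.univ.image (I ⟨p.N - p.C + j, h⟩) ⊆ colluderIndices p I :=
  Finset.subset_biUnion_of_mem (fun j : Fin p.C => Finset.univ.image (I ⟨p.N - p.C + j, by
    have h : p.C ≤ p.N := p.collusion_le
    have hj := j.isLt
    omega⟩)) (Finset.mem_univ j)

/-- The bound on the winning probability for fixed `A` and fixed indices of all keys. -/
lemma expect_vectors_winProb_le {p : Params} {G : GateSet} {w : ℕ} (adv : Adversary p G w)
    (A : HalfSubspace p.n) (I J : Fin p.N → Fin p.t → Fin (p.n / 2)) {δ : ℝ} (hδ : 0 < δ) :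
    𝔼 v : Fin (p.n / 2) → A.1, 𝔼 w' : Fin (p.n / 2) → perp A.1,
        adv.winProb (⟨A, I, J, v, w'⟩ : MSK p) (zeroState w)
      ≤ hybridBound δ (keyError p I J) adv.time := by
  refine expect_le_of_piecewise (colluderIndices p I) _ _ fun v₀ => ?_
  rw [Finset.expect_comm]
  refine expect_le_of_piecewise (colluderIndices p J) _ _ fun w₀ => ?_
  rw [Finset.expect_comm]
  have h := expect_winProb_le (G := G)
    (fun o : (Fin (p.n / 2) → A.1) × (Fin (p.n / 2) → perp A.1) =>
      (⟨A, I, J, (colluderIndices p I).piecewise v₀ o.1,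
        (colluderIndices p J).piecewise w₀ o.2⟩ : MSK p))
    A (fun _ => rfl) (colluderKey ⟨A, I, J, v₀, w₀⟩)
    (fun o j => Prod.ext
      (halfKey_piecewise _ (image_subset_colluderIndices p I j _) v₀ o.1)
      (halfKey_piecewise _ (image_subset_colluderIndices p J j _) w₀ o.2))
    hδ (keyError_nonneg p I J)
    (fun id φ => (expect_normSq_verOp_sub_le A I J v₀ w₀ id φ).trans (by
      refine mul_le_mul_of_nonneg_right ?_ (normSq_nonneg φ)
      refine mul_le_mul_of_nonneg_left ?_ (by norm_num)
      exact Finset.single_le_sum (f := fun id : Honest p =>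
          (1 / 2 : ℝ) ^ (freshIndices p I id).card + (1 / 2) ^ (freshIndices p J id).card)
        (fun _ _ => by positivity) (Finset.mem_univ id)))
    adv (zeroState w) le_rfl
  rwa [normSq_zeroState, mul_one, ← Finset.univ_product_univ, Finset.expect_product] at h

/-! ### Averaging over the indices -/

lemma card_colluderIndices_le (p : Params) (I : Fin p.N → Fin p.t → Fin (p.n / 2)) :
    4 * (colluderIndices p I).card ≤ p.n := by
  have h1 : (colluderIndices p I).card ≤ p.C * p.t := by
    refine Finset.card_biUnion_le.trans ?_
    refine (Finset.sum_le_card_nsmul _ _ p.t fun j _ => ?_).trans (by simp)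
    exact Finset.card_image_le.trans (by simp)
  have h2 : p.n / (4 * p.t) * (4 * p.t) ≤ p.n := Nat.div_mul_le_self _ _
  have h3 : 4 * (p.C * p.t) = p.n / (4 * p.t) * (4 * p.t) := by
    unfold Params.C
    ring
  omega

lemma expect_half_pow_card_freshIndices_le (p : Params) (ht : 8 * p.t ≤ p.n) (id : Honest p) :
    𝔼 I : Fin p.N → Fin p.t → Fin (p.n / 2), (1 / 2 : ℝ) ^ (freshIndices p I id).card
      ≤ (7 / 8) ^ p.t := by
  obtain ⟨m, hm⟩ := p.n_even
  have hpos := p.n_pos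
  have : Nonempty (Fin (p.n / 2)) := ⟨⟨0, by omega⟩⟩
  set i₀ : Fin p.N := Fin.castLE (Nat.sub_le _ _) id with hi₀
  have hC : p.C ≤ p.N := p.collusion_le
  refine expect_le_of_piecewise (Finset.univ.erase i₀) _ _ fun I₀ => ?_
  -- The colluders' indices do not depend on the redrawn key.
  have hcol : ∀ I : Fin p.N → Fin p.t → Fin (p.n / 2),
      colluderIndices p ((Finset.univ.erase i₀).piecewise I₀ I) = colluderIndices p I₀ := by
    intro I
    refine Finset.biUnion_congr rfl fun j _ => ?_
    rw [Finset.piecewise_eq_of_mem]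
    refine Finset.mem_erase.2 ⟨fun h => ?_, Finset.mem_univ _⟩
    have h1 := congrArg Fin.val h
    have h2 := id.isLt
    simp only [hi₀, Fin.val_castLE] at h1
    omega
  have hfresh : ∀ I : Fin p.N → Fin p.t → Fin (p.n / 2),
      freshIndices p ((Finset.univ.erase i₀).piecewise I₀ I) id
        = Finset.univ.image (I i₀) \ colluderIndices p I₀ := by
    intro I
    rw [freshIndices, hcol, Finset.piecewise_eq_of_notMem _ _ _ (by simp [hi₀])]
  simp_rw [hfresh]
  rw [expect_apply_eq i₀ fun f : Fin p.t → Fin (p.n / 2) =>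
    (1 / 2 : ℝ) ^ (Finset.univ.image f \ colluderIndices p I₀).card]
  refine expect_half_pow_card_sdiff_le _ _ ?_
  have := card_colluderIndices_le p I₀
  omega

lemma expect_keyError_le (p : Params) (ht : 8 * p.t ≤ p.n) :
    𝔼 I : Fin p.N → Fin p.t → Fin (p.n / 2), 𝔼 J : Fin p.N → Fin p.t → Fin (p.n / 2),
      keyError p I J ≤ 16 * p.N * (7 / 8) ^ p.t := by
  obtain ⟨m, hm⟩ := p.n_even
  have hpos := p.n_pos
  have : Nonempty (Fin (p.n / 2)) := ⟨⟨0, by omega⟩⟩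
  unfold keyError
  simp_rw [← Finset.mul_expect, Finset.expect_sum_comm, Finset.expect_add_distrib,
    Fintype.expect_const]
  have hterm := expect_half_pow_card_freshIndices_le p ht
  calc _ ≤ 8 * ∑ _id : Honest p, ((7 / 8 : ℝ) ^ p.t + (7 / 8) ^ p.t) := by
        gcongr with id
        · exact hterm id
        · exact hterm id
    _ = 16 * (p.N - p.C : ℕ) * (7 / 8) ^ p.t := by
        rw [Finset.sum_const, Finset.card_univ, Fintype.card_fin, nsmul_eq_mul]
        ring
    _ ≤ _ := by
        gcongr
        exact Nat.sub_le _ _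

lemma Adversary.one_le_time {p : Params} {G : GateSet} {w : ℕ} (adv : Adversary p G w) :
    1 ≤ adv.time := by
  cases adv <;> simp [Adversary.time]

lemma hybridBound_inv_le {k : ℕ} (hk : 1 ≤ k) {ε : ℝ} (hε : 0 ≤ ε) :
    hybridBound (k : ℝ)⁻¹ ε k ≤ 3 * (k * (k + 1)) * ε := by
  have hk' : (0 : ℝ) < k := by exact_mod_cast hk
  have h1 : (1 + (k : ℝ)⁻¹) ^ k ≤ 3 := by
    calc (1 + (k : ℝ)⁻¹) ^ k ≤ Real.exp (k : ℝ)⁻¹ ^ k := by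
          gcongr
          rw [add_comm]
          exact Real.add_one_le_exp _
      _ = Real.exp 1 := by
          rw [← Real.exp_nat_mul, mul_inv_cancel₀ hk'.ne']
      _ ≤ 3 := Real.exp_one_lt_three.le
  unfold hybridBound
  rw [inv_inv]
  calc (k : ℝ) * (1 + (k : ℝ)⁻¹) ^ k * ((1 + k) * ε) ≤ k * 3 * ((1 + k) * ε) := by gcongr
    _ = _ := by ring

/-- The concrete security bound. -/
lemma sabotageProb_le {p : Params} {G : GateSet} {w : ℕ} (adv : Adversary p G w)
    (ht : 8 * p.t ≤ p.n) :
    sabotageProb adv ≤ 48 * (adv.time * (adv.time + 1) * p.N) * (7 / 8) ^ p.t := by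
  have hk := adv.one_le_time
  have hδ : (0 : ℝ) < (adv.time : ℝ)⁻¹ := by
    have : (0 : ℝ) < adv.time := by exact_mod_cast hk
    positivity
  have hA : ∀ A : HalfSubspace p.n,
      𝔼 I : Fin p.N → Fin p.t → Fin (p.n / 2), 𝔼 J : Fin p.N → Fin p.t → Fin (p.n / 2),
        𝔼 v : Fin (p.n / 2) → A.1, 𝔼 w' : Fin (p.n / 2) → perp A.1,
          adv.winProb (⟨A, I, J, v, w'⟩ : MSK p) (zeroState w)
      ≤ 48 * (adv.time * (adv.time + 1) * p.N) * (7 / 8) ^ p.t := by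
    intro A
    calc _ ≤ 𝔼 I : Fin p.N → Fin p.t → Fin (p.n / 2), 𝔼 J : Fin p.N → Fin p.t → Fin (p.n / 2),
          3 * (adv.time * (adv.time + 1)) * keyError p I J :=
          Finset.expect_le_expect fun I _ => Finset.expect_le_expect fun J _ =>
            (expect_vectors_winProb_le adv A I J hδ).trans
              (hybridBound_inv_le hk (keyError_nonneg p I J))
      _ = 3 * (adv.time * (adv.time + 1)) * 𝔼 I : Fin p.N → Fin p.t → Fin (p.n / 2),
          𝔼 J : Fin p.N → Fin p.t → Fin (p.n / 2), keyError p I J := by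
          simp_rw [Finset.mul_expect]
      _ ≤ 3 * (adv.time * (adv.time + 1)) * (16 * p.N * (7 / 8) ^ p.t) := by
          gcongr
          exact expect_keyError_le p ht
      _ = _ := by ring
  unfold sabotageProb setupExpect
  rcases isEmpty_or_nonempty (HalfSubspace p.n) with h | h
  · rw [Finset.univ_eq_empty, Finset.expect_empty]
    positivity
  · exact Finset.expect_le Finset.univ_nonempty fun A _ => hA A

lemma sabotageProb_nonneg {p : Params} {G : GateSet} {w : ℕ} (adv : Adversary p G w) :
    0 ≤ sabotageProb adv :=
  Finset.expect_nonneg fun _ _ => Finset.expect_nonneg fun _ _ => Finset.expect_nonneg fun _ _ =>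
    Finset.expect_nonneg fun _ _ => Finset.expect_nonneg fun _ _ =>
      Adversary.winProb_nonneg _ _ _

/-! ### Asymptotics -/

lemma isBigO_polynomial_eval (P : Polynomial ℕ) :
    (fun l : ℕ => ((P.eval l : ℕ) : ℝ)) =O[atTop] fun l : ℕ => (l : ℝ) ^ P.natDegree := by
  have h := (Polynomial.isBigO_atTop_of_degree_le (P.map (Nat.castRingHom ℝ))
    (Polynomial.X ^ P.natDegree : Polynomial ℝ) (by
      rw [Polynomial.degree_X_pow]
      exact Polynomial.degree_map_le.trans Polynomial.degree_le_natDegree)).comp_tendsto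
    tendsto_natCast_atTop_atTop
  refine h.congr (fun l => ?_) (fun l => ?_)
  · simp [Polynomial.eval_natCast_map]
  · simp

/-- A function bounded by a polynomial times a fixed power `ρ ^ t` with `ρ < 1` is negligible if
`t` grows at least like `√l`. -/
lemma negligible_of_le_pow {f : ℕ → ℝ} (P : Polynomial ℕ) (t : ℕ → ℕ) {ρ a : ℝ} (hρ : 0 < ρ)
    (hρ1 : ρ < 1) (ha : 0 < a) (ht : ∀ᶠ l in atTop, a * Real.sqrt (l : ℕ) ≤ t l)
    (hf0 : ∀ l, 0 ≤ f l) (hf : ∀ᶠ l in atTop, f l ≤ P.eval l * ρ ^ t l) : Negligible f := by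
  intro c
  have hlog : 0 < -Real.log ρ := neg_pos.2 (Real.log_neg hρ hρ1)
  set b : ℝ := -Real.log ρ * a with hb
  have hb0 : 0 < b := mul_pos hlog ha
  have h1 : f =O[atTop] fun l : ℕ => ((P.eval l : ℕ) : ℝ) * Real.exp (-b * Real.sqrt l) := by
    refine IsBigO.of_bound 1 ?_
    filter_upwards [ht, hf] with l hl hfl
    rw [one_mul, Real.norm_of_nonneg (hf0 l), Real.norm_of_nonneg (by positivity)]
    refine hfl.trans (mul_le_mul_of_nonneg_left ?_ (by positivity))
    rw [← Real.exp_log (pow_pos hρ (t l)), Real.log_pow]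
    refine Real.exp_le_exp.2 ?_
    have := mul_le_mul_of_nonneg_left hl hlog.le
    rw [hb]
    linarith
  have hsqrt : Tendsto (fun l : ℕ => Real.sqrt (l : ℝ)) atTop atTop :=
    Real.tendsto_sqrt_atTop.comp tendsto_natCast_atTop_atTop
  have h2 : (fun l : ℕ => Real.exp (-b * Real.sqrt l))
      =o[atTop] fun l : ℕ => (Real.sqrt l) ^ (2 * (-c - P.natDegree)) :=
    (isLittleO_exp_neg_mul_rpow_atTop hb0 _).comp_tendsto hsqrt
  refine (h1.trans_isLittleO ((isBigO_polynomial_eval P).mul_isLittleO h2)).congr' (by rfl) ?_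
  filter_upwards [eventually_gt_atTop 0] with l hl
  have hl' : (0 : ℝ) < l := by exact_mod_cast hl
  rw [Real.rpow_mul (Real.sqrt_nonneg _), Real.rpow_two, Real.sq_sqrt hl'.le,
    ← Real.rpow_natCast (l : ℝ), ← Real.rpow_add hl']
  congr 1
  ring

end FQM

theorem mainTheorem4 (p : ℕ → FQM.Params)
    (hn : (fun l : ℕ => (l : ℝ)) =O[atTop] fun l => ((p l).n : ℝ))
    (ht : (fun l : ℕ => ((p l).t : ℝ)) =Θ[atTop] fun l => Real.sqrt (p l).n)
    (hN : FQM.PolyBounded fun l => (p l).N) :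
    FQM.SecureAgainstSabotage p 1 := by
  intro G w adv htime _
  obtain ⟨P, hP⟩ := htime
  obtain ⟨Q, hQ⟩ := hN
  obtain ⟨a, ha, hna⟩ := hn.exists_pos
  obtain ⟨b, hb, htb⟩ := ht.1.exists_pos
  obtain ⟨d, hd, htd⟩ := ht.2.exists_pos
  -- `l ≤ a n` and `√n ≤ d t`, hence `√l ≤ √a d t`.
  have hsqrt : ∀ᶠ l in atTop, (Real.sqrt a * d)⁻¹ * Real.sqrt (l : ℕ) ≤ (p l).t := by
    filter_upwards [hna.bound, htd.bound] with l h1 h2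
    rw [Real.norm_of_nonneg (by positivity), Real.norm_of_nonneg (by positivity)] at h1 h2
    rw [inv_mul_le_iff₀ (by positivity)]
    calc Real.sqrt l ≤ Real.sqrt (a * (p l).n) := Real.sqrt_le_sqrt h1
      _ = Real.sqrt a * Real.sqrt (p l).n := Real.sqrt_mul ha.le _
      _ ≤ Real.sqrt a * (d * (p l).t) := by gcongr
      _ = _ := by ring
  -- `t ≤ b √n`, and `8 b ≤ √n` for large `l`.
  have hsmall : ∀ᶠ l in atTop, 8 * (p l).t ≤ (p l).n := by
    filter_upwards [hna.bound, htb.bound,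
      tendsto_natCast_atTop_atTop.eventually_ge_atTop (a * (8 * b) ^ 2)] with l h1 h2 h3
    rw [Real.norm_of_nonneg (by positivity), Real.norm_of_nonneg (by positivity)] at h1 h2
    have h4 : (8 * b) ^ 2 ≤ (p l).n := le_of_mul_le_mul_left (h3.trans h1) ha
    have h5 : 8 * b ≤ Real.sqrt (p l).n := Real.le_sqrt_of_sq_le h4
    have h6 : (8 : ℝ) * (p l).t ≤ (p l).n := by
      calc (8 : ℝ) * (p l).t ≤ 8 * (b * Real.sqrt (p l).n) := by gcongr
        _ = (8 * b) * Real.sqrt (p l).n := by ring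
        _ ≤ Real.sqrt (p l).n * Real.sqrt (p l).n := by gcongr
        _ = (p l).n := Real.mul_self_sqrt (by positivity)
    exact_mod_cast h6
  refine FQM.negligible_of_le_pow (48 * (P * (P + 1) * Q)) (fun l => (p l).t) (ρ := 7 / 8)
    (by norm_num) (by norm_num) (by positivity) hsqrt
    (fun l => FQM.sabotageProb_nonneg (adv l)) ?_
  filter_upwards [hsmall] with l hl
  refine (FQM.sabotageProb_le (adv l) hl).trans ?_
  refine mul_le_mul_of_nonneg_right ?_ (by positivity)
  have h1 : ((adv l).time : ℝ) ≤ (P.eval l : ℕ) := by exact_mod_cast hP l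
  have h2 : ((p l).N : ℝ) ≤ (Q.eval l : ℕ) := by exact_mod_cast hQ l
  simp only [Polynomial.eval_mul, Polynomial.eval_add, Polynomial.eval_one,
    Polynomial.eval_ofNat]
  push_cast
  gcongr
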